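/- Let $n\ge 0$ and let $O(n)$ be the group of orthogonal linear transformations of Euclidean space $\mathbb{R}^n$. For a hyperplane $H\subset\mathbb{R}^n$ (a linear subspace of codimension 1) let $R_H\in O(n)$ be the orthogonal reflection in $H$. An involution relation is a relation $R_l\circ R_l=\mathrm{id}$, where $l$ is a hyperplane. A pencil relation is a relation $R_m\circ R_l=R_{m'}\circ R_{l'}$ that holds in $O(n)$, where $l,m,l',m'$ are hyperplanes all containing a common linear subspace of codimension 2. Then in $O(n)$ every relation among reflections in hyperplanes follows from the pencil and involution relations. That is, if $F$ is the free group on the set of hyperplanes of $\mathbb{R}^n$, then an element $w\in F$ lies in the kernel of the homomorphism $F\to O(n)$, $H\mapsto R_H$, if and only if $w$ belongs to the normal subgroup of $F$ generated by all words $ml\,(m'l')^{-1}$ of pencil relations and all words $l^2$ of involution relations. -/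

import Mathlib

namespace OrthogonalReflections

/-- A hyperplane of `ℝⁿ`: a linear subspace of codimension one. -/
abbrev Hyperplane (n : ℕ) : Type :=
  {H : Submodule ℝ (EuclideanSpace ℝ (Fin n)) // Module.finrank ℝ H + 1 = n}

/-- The orthogonal group `O(n)`: linear isometries of Euclidean `ℝⁿ`, with composition
as multiplication. -/
abbrev O (n : ℕ) : Type :=
  EuclideanSpace ℝ (Fin n) ≃ₗᵢ[ℝ] EuclideanSpace ℝ (Fin n)

/-- The orthogonal reflection `R_H` in a hyperplane `H`, as an element of `O(n)`. -/
noncomputable def reflectionIn {n : ℕ} (H : Hyperplane n) : O n := H.1.reflection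

/-- The evaluation of a formal word in reflections (an element of the free group on the set
of hyperplanes) as an element of `O(n)`. -/
noncomputable def evalWord (n : ℕ) : FreeGroup (Hyperplane n) →* O n := FreeGroup.lift reflectionIn

/-- Four hyperplanes belong to one pencil: all of them contain a common linear subspace of
codimension two. -/
def InPencil {n : ℕ} (l m l' m' : Hyperplane n) : Prop :=
  ∃ P : Submodule ℝ (EuclideanSpace ℝ (Fin n)), Module.finrank ℝ P + 2 = n ∧
    P ≤ l.1 ∧ P ≤ m.1 ∧ P ≤ l'.1 ∧ P ≤ m'.1

/-- The pencil relations `R_m ∘ R_l = R_m' ∘ R_l'`, written as words: one for each quadruple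
of hyperplanes of one pencil for which the two compositions are the same map. -/
def pencilRelations (n : ℕ) : Set (FreeGroup (Hyperplane n)) :=
  {w | ∃ l m l' m' : Hyperplane n, InPencil l m l' m' ∧
    reflectionIn m * reflectionIn l = reflectionIn m' * reflectionIn l' ∧
    w = (FreeGroup.of m * FreeGroup.of l) * (FreeGroup.of m' * FreeGroup.of l')⁻¹}

/-- The involution relations `R_l ∘ R_l = id`, written as words. -/
def involutionRelations (n : ℕ) : Set (FreeGroup (Hyperplane n)) :=
  {w | ∃ l : Hyperplane n, w = FreeGroup.of l * FreeGroup.of l}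

end OrthogonalReflections

/-!
Write `r v` for the class, modulo the pencil and involution relations, of the hyperplane `vᗮ`
orthogonal to a nonzero vector `v`. Every element of the quotient is a product of such classes,
since each generator is its own inverse.

The geometric input is that in a plane the product of three reflections is a reflection
(`reflection_mul_reflection_eq`): if `v = a • x + b • u`, then `R_x ∘ R_u = R_v ∘ R_y` for an
explicit `y` in the span of `x` and `u`. Hence `r x * r u = r v * r y`, which lets one choose the
first factor of a product of two generators freely within their plane. By induction
(`exists_word_cons_eq`), a product `r v₁ * ⋯ * r vₖ` can be rewritten, without changing its length,
to start with `r v` for any nonzero `v` in the span of `v₁, …, vₖ`.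

Now let `R_{v₁} ∘ ⋯ ∘ R_{vₖ} = id` with `k > 0`. Then `R_{v₂} ∘ ⋯ ∘ R_{vₖ}` sends `v₁` to `-v₁`, and
as it moves each vector by an element of the span of `v₂, …, vₖ`, this span contains `v₁`.
So `r v₂ * ⋯ * r vₖ` can be rewritten to start with `r v₁`, which cancels against the first factor
of the word and leaves a word of length `k - 2` (`word_eq_one`).
-/

namespace OrthogonalReflections

open Submodule

/-! ### Reflections in the plane of two vectors -/

section InnerProductSpace

variable {E : Type*} [NormedAddCommGroup E] [InnerProductSpace ℝ E]

lemma reflection_orthogonal_singleton_apply (v x : E) :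
    (ℝ ∙ v)ᗮ.reflection x = x - (2 * inner ℝ v x / inner ℝ v v) • v := by
  rw [reflection_orthogonal_apply, reflection_singleton_apply, real_inner_self_eq_norm_sq,
    neg_sub, two_smul, ← add_smul]
  simp only [RCLike.ofReal_real_eq_id, id_eq]
  congr 2
  ring

/-- The Clifford product `(a • x + b • u) * x * u`, which is again a vector. -/
noncomputable def tripleProduct (a b : ℝ) (x u : E) : E :=
  (a * inner ℝ x x + 2 * b * inner ℝ x u) • u - (b * inner ℝ u u) • x

lemma inner_tripleProduct_self (a b : ℝ) (x u : E) :
    inner ℝ (tripleProduct a b x u) (tripleProduct a b x u) =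
      inner ℝ (a • x + b • u) (a • x + b • u) * inner ℝ x x * inner ℝ u u := by
  simp only [tripleProduct, inner_sub_left, inner_sub_right, inner_add_left, inner_add_right,
    real_inner_smul_left, real_inner_smul_right, real_inner_comm x u]
  ring

lemma tripleProduct_ne_zero {a b : ℝ} {x u : E} (hx : x ≠ 0) (hu : u ≠ 0)
    (hv : a • x + b • u ≠ 0) : tripleProduct a b x u ≠ 0 := by
  rw [← inner_self_ne_zero (𝕜 := ℝ), inner_tripleProduct_self]
  exact mul_ne_zero (mul_ne_zero (inner_self_ne_zero.2 hv) (inner_self_ne_zero.2 hx))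
    (inner_self_ne_zero.2 hu)

/-- In a plane, the first of two reflections may be chosen freely without changing the product. -/
lemma reflection_mul_reflection_eq {a b : ℝ} {x u : E} (hx : x ≠ 0) (hu : u ≠ 0)
    (hv : a • x + b • u ≠ 0) :
    (ℝ ∙ x)ᗮ.reflection * (ℝ ∙ u)ᗮ.reflection =
      (ℝ ∙ (a • x + b • u))ᗮ.reflection * (ℝ ∙ tripleProduct a b x u)ᗮ.reflection := by
  ext z
  have hx' : inner ℝ x x ≠ 0 := inner_self_ne_zero.2 hx
  have hu' : inner ℝ u u ≠ 0 := inner_self_ne_zero.2 hu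
  have hv' : inner ℝ (a • x + b • u) (a • x + b • u) ≠ 0 := inner_self_ne_zero.2 hv
  simp only [LinearIsometryEquiv.coe_mul, Function.comp_apply,
    reflection_orthogonal_singleton_apply, inner_tripleProduct_self]
  -- The squared norm `D` of `a • x + b • u` stays an atom until denominators are cleared.
  generalize hD : inner ℝ (a • x + b • u) (a • x + b • u) = D at *
  simp only [tripleProduct, inner_sub_left, inner_add_left, inner_add_right,
    real_inner_smul_left, inner_sub_right, real_inner_smul_right, real_inner_comm x u] at hD ⊢
  generalize inner ℝ x x = p at *
  generalize inner ℝ u u = q at *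
  generalize inner ℝ x u = c at *
  generalize inner ℝ x z = X at *
  generalize inner ℝ u z = Y at *
  match_scalars
  · ring
  · field_simp
    rw [← hD]
    ring
  · field_simp
    rw [← hD]
    ring

end InnerProductSpace

/-! ### Generators indexed by normal vectors -/

section Words

variable {n : ℕ}

/-- The normal closure of the pencil and involution relations. -/
abbrev relationSubgroup (n : ℕ) : Subgroup (FreeGroup (Hyperplane n)) :=
  Subgroup.normalClosure (pencilRelations n ∪ involutionRelations n)

/-- Nonzero vectors, serving as normal vectors of hyperplanes. -/
abbrev Normal (n : ℕ) : Type := {v : EuclideanSpace ℝ (Fin n) // v ≠ 0}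

/-- The hyperplane orthogonal to a nonzero vector. -/
noncomputable def normalHyperplane (v : Normal n) : Hyperplane n :=
  ⟨(ℝ ∙ v.1)ᗮ, by
    have h := (ℝ ∙ v.1).finrank_add_finrank_orthogonal
    rw [finrank_span_singleton v.2, finrank_euclideanSpace_fin] at h
    omega⟩

lemma normalHyperplane_surjective : Function.Surjective (normalHyperplane (n := n)) := by
  rintro ⟨H, hH⟩
  have h := H.finrank_add_finrank_orthogonal
  rw [finrank_euclideanSpace_fin] at h
  obtain ⟨v, hv, hspan⟩ := finrank_eq_one_iff'.1 (show Module.finrank ℝ Hᗮ = 1 by omega)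
  refine ⟨⟨v, by simpa using hv⟩, Subtype.ext ?_⟩
  have : (ℝ ∙ (v : EuclideanSpace ℝ (Fin n))) = Hᗮ := by
    apply le_antisymm
    · simp
    · intro w hw
      obtain ⟨c, hc⟩ := hspan ⟨w, hw⟩
      exact mem_span_singleton.2 ⟨c, congrArg Subtype.val hc⟩
  simp [normalHyperplane, this]

lemma normalHyperplane_eq_of_smul {v x : Normal n} {a : ℝ} (h : v.1 = a • x.1) :
    normalHyperplane v = normalHyperplane x := by
  have ha : a ≠ 0 := by
    rintro rfl
    exact v.2 (by simpa using h)
  refine Subtype.ext ?_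
  simp only [normalHyperplane, h, span_singleton_smul_eq (IsUnit.mk0 a ha)]

/-- The class of the hyperplane orthogonal to `v` in the group presented by the pencil and
involution relations. -/
noncomputable def gen (v : Normal n) : FreeGroup (Hyperplane n) ⧸ relationSubgroup n :=
  (FreeGroup.of (normalHyperplane v) : FreeGroup (Hyperplane n))

/-- The element `R_v` of `O(n)`. -/
noncomputable def refl (v : Normal n) : O n := reflectionIn (normalHyperplane v)

lemma gen_mul_self (v : Normal n) : gen v * gen v = 1 :=
  (QuotientGroup.eq_one_iff _).2 (Subgroup.subset_normalClosure (Or.inr ⟨_, rfl⟩))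

/-- A product of two generators can be rewritten to start with any prescribed generator of their
plane. -/
lemma exists_gen_mul_gen_eq {x u v : Normal n} {a b : ℝ} (hv : v.1 = a • x.1 + b • u.1) :
    ∃ y : Normal n, gen x * gen u = gen v * gen y := by
  by_cases hli : LinearIndependent ℝ ![x.1, u.1]
  · have hv0 : a • x.1 + b • u.1 ≠ 0 := hv ▸ v.2
    let y : Normal n := ⟨tripleProduct a b x.1 u.1, tripleProduct_ne_zero x.2 u.2 hv0⟩
    refine ⟨y, ?_⟩
    have hx : x.1 ∈ span ℝ {x.1, u.1} := mem_span_pair.2 ⟨1, 0, by simp⟩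
    have hu : u.1 ∈ span ℝ {x.1, u.1} := mem_span_pair.2 ⟨0, 1, by simp⟩
    have hle {z : Normal n} (hz : z.1 ∈ span ℝ {x.1, u.1}) :
        (span ℝ {x.1, u.1})ᗮ ≤ (normalHyperplane z).1 :=
      orthogonal_le ((span_singleton_le_iff_mem _ _).2 hz)
    have hmem : FreeGroup.of (normalHyperplane x) * FreeGroup.of (normalHyperplane u) *
        (FreeGroup.of (normalHyperplane v) * FreeGroup.of (normalHyperplane y))⁻¹ ∈
          relationSubgroup n := by
      refine Subgroup.subset_normalClosure (Or.inl ⟨_, _, _, _,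
        ⟨(span ℝ {x.1, u.1})ᗮ, ?_, hle hu, hle hx, hle ?_, hle ?_⟩, ?_, rfl⟩)
      · have h := (span ℝ {x.1, u.1}).finrank_add_finrank_orthogonal
        have h2 := finrank_span_eq_card hli
        rw [Matrix.range_cons_cons_empty, Fintype.card_fin] at h2
        rw [finrank_euclideanSpace_fin] at h
        omega
      · exact sub_mem (smul_mem _ _ hu) (smul_mem _ _ hx)
      · exact hv ▸ add_mem (smul_mem _ _ hx) (smul_mem _ _ hu)
      · have h := reflection_mul_reflection_eq x.2 u.2 hv0
        simp only [← hv] at h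
        exact h
    have h := (QuotientGroup.eq_one_iff _).2 hmem
    rwa [QuotientGroup.mk_mul, QuotientGroup.mk_inv, mul_inv_eq_one] at h
  · -- If `x` and `u` are parallel, then so are `x` and `v`, and `y = u` works.
    rw [LinearIndependent.pair_iff' x.2] at hli
    push Not at hli
    obtain ⟨c, hc⟩ := hli
    refine ⟨u, ?_⟩
    rw [gen, gen, gen,
      normalHyperplane_eq_of_smul (show v.1 = (a + b * c) • x.1 by rw [hv, ← hc]; module)]

/-! ### Rewriting words -/

/-- The span of the normal vectors occurring in a word. -/
def wordSpan (L : List (Normal n)) : Submodule ℝ (EuclideanSpace ℝ (Fin n)) :=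
  span ℝ {v | ∃ x ∈ L, x.1 = v}

lemma wordSpan_cons (x : Normal n) (L : List (Normal n)) :
    wordSpan (x :: L) = (ℝ ∙ x.1) ⊔ wordSpan L := by
  rw [wordSpan, wordSpan, ← span_union]
  congr 1
  ext v
  simp [eq_comm]

/-- A word can be rewritten, keeping its length, to start with any nonzero vector of its span. -/
lemma exists_word_cons_eq (L : List (Normal n)) (v : Normal n) (hv : v.1 ∈ wordSpan L) :
    ∃ L' : List (Normal n), L'.length + 1 = L.length ∧
      (L.map gen).prod = gen v * (L'.map gen).prod := by
  induction L generalizing v with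
  | nil => exact absurd (by simpa [wordSpan] using hv) v.2
  | cons x L ih =>
    rw [wordSpan_cons, mem_sup] at hv
    obtain ⟨_, hx, u, hu, hv⟩ := hv
    obtain ⟨a, rfl⟩ := mem_span_singleton.1 hx
    by_cases hu0 : u = 0
    · refine ⟨L, rfl, ?_⟩
      rw [List.map_cons, List.prod_cons, gen, gen,
        normalHyperplane_eq_of_smul (show v.1 = a • x.1 by rw [← hv, hu0, add_zero])]
    · obtain ⟨L', hlen, hL'⟩ := ih ⟨u, hu0⟩ hu
      obtain ⟨y, hy⟩ := exists_gen_mul_gen_eq (x := x) (u := ⟨u, hu0⟩) (v := v) (a := a) (b := 1)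
        (by rw [one_smul, hv])
      refine ⟨y :: L', by simpa using hlen, ?_⟩
      rw [List.map_cons, List.prod_cons, hL', ← mul_assoc, hy, mul_assoc, List.map_cons,
        List.prod_cons]

/-- A product of reflections moves every vector by an element of the span of their normals. -/
lemma sub_prod_refl_apply_mem (L : List (Normal n)) (z : EuclideanSpace ℝ (Fin n)) :
    z - (L.map refl).prod z ∈ wordSpan L := by
  induction L with
  | nil => simp
  | cons x L ih =>
    rw [wordSpan_cons, List.map_cons, List.prod_cons, LinearIsometryEquiv.coe_mul,
      Function.comp_apply]
    have h : refl x ((L.map refl).prod z) = _ := reflection_orthogonal_singleton_apply _ _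
    rw [h, ← sub_add]
    exact add_mem (mem_sup_right ih) (mem_sup_left (smul_mem _ _ (mem_span_singleton_self _)))

lemma refl_apply_self (v : Normal n) : refl v v.1 = -v.1 :=
  reflection_orthogonalComplement_singleton_eq_neg v.1

lemma refl_mul_self (v : Normal n) : refl v * refl v = 1 := reflection_mul_reflection _

/-- The homomorphism from the presented group to `O(n)` induced by evaluation of words. -/
noncomputable def evalQuotient (n : ℕ) : FreeGroup (Hyperplane n) ⧸ relationSubgroup n →* O n :=
  QuotientGroup.lift (relationSubgroup n) (evalWord n) <| by
    refine Subgroup.normalClosure_le_normal (N := (evalWord n).ker) ?_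
    rintro w (⟨l, m, l', m', -, h, rfl⟩ | ⟨l, rfl⟩)
    · simp only [SetLike.mem_coe, MonoidHom.mem_ker, map_mul, map_inv, mul_inv_eq_one]
      simpa [evalWord] using h
    · simp only [SetLike.mem_coe, MonoidHom.mem_ker, map_mul]
      rw [evalWord, FreeGroup.lift_apply_of]
      exact reflection_mul_reflection l.1

lemma evalQuotient_gen (v : Normal n) : evalQuotient n (gen v) = refl v :=
  FreeGroup.lift_apply_of

lemma evalQuotient_word (L : List (Normal n)) :
    evalQuotient n (L.map gen).prod = (L.map refl).prod := by
  rw [map_list_prod, List.map_map]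
  exact congrArg _ (List.map_congr_left fun v _ => evalQuotient_gen v)

/-- A word of hyperplanes that evaluates to the identity is trivial in the presented group. -/
lemma word_eq_one (L : List (Normal n)) (hL : (L.map refl).prod = 1) : (L.map gen).prod = 1 := by
  induction hk : L.length using Nat.strong_induction_on generalizing L with
  | h k ih =>
    cases L with
    | nil => rfl
    | cons v L =>
      rw [List.map_cons, List.prod_cons] at hL
      have hprod : (L.map refl).prod = refl v := by
        rw [← mul_left_cancel_iff (a := refl v), hL, refl_mul_self]
      have hv : v.1 ∈ wordSpan L := by
        have h := sub_prod_refl_apply_mem L v.1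
        rw [hprod, refl_apply_self, sub_neg_eq_add, ← two_smul ℝ] at h
        exact (smul_mem_iff _ two_ne_zero).1 h
      obtain ⟨L', hlen, hL'⟩ := exists_word_cons_eq L v hv
      have hw : ((v :: L).map gen).prod = (L'.map gen).prod := by
        rw [List.map_cons, List.prod_cons, hL', ← mul_assoc, gen_mul_self, one_mul]
      rw [hw]
      refine ih L'.length (by simp at hk; omega) L' ?_ rfl
      rw [← evalQuotient_word, ← hw, evalQuotient_word, List.map_cons, List.prod_cons, hL]

/-- Since generators are involutions, positive words suffice. -/
lemma exists_word_eq (g : FreeGroup (Hyperplane n) ⧸ relationSubgroup n) :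
    ∃ L : List (Normal n), (L.map gen).prod = g := by
  obtain ⟨w, rfl⟩ := QuotientGroup.mk_surjective g
  induction w using FreeGroup.induction_on with
  | C1 => exact ⟨[], rfl⟩
  | of l =>
    obtain ⟨v, rfl⟩ := normalHyperplane_surjective l
    exact ⟨[v], by simp [gen]⟩
  | inv_of l _ =>
    obtain ⟨v, rfl⟩ := normalHyperplane_surjective l
    exact ⟨[v], by simpa [gen] using eq_inv_of_mul_eq_one_left (gen_mul_self v)⟩
  | mul x y hx hy =>
    obtain ⟨L, hL⟩ := hx
    obtain ⟨M, hM⟩ := hy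
    exact ⟨L ++ M, by rw [List.map_append, List.prod_append, hL, hM, QuotientGroup.mk_mul]⟩

end Words

end OrthogonalReflections

theorem theorem5 (n : ℕ) (w : FreeGroup (OrthogonalReflections.Hyperplane n)) :
    OrthogonalReflections.evalWord n w = 1 ↔
      w ∈ Subgroup.normalClosure
        (OrthogonalReflections.pencilRelations n ∪
          OrthogonalReflections.involutionRelations n) := by
  have heval : OrthogonalReflections.evalQuotient n w = OrthogonalReflections.evalWord n w := rfl
  rw [← heval, ← QuotientGroup.eq_one_iff]
  refine ⟨fun h => ?_, fun h => by rw [h, map_one]⟩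
  obtain ⟨L, hL⟩ := OrthogonalReflections.exists_word_eq
    (w : _ ⧸ OrthogonalReflections.relationSubgroup n)
  rw [← hL, OrthogonalReflections.evalQuotient_word] at h
  rw [← hL]
  exact OrthogonalReflections.word_eq_one L h
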